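/- Let $n\ge 2$, and let $\mathfrak S_n$ act on $\mathbb C[x_1,\dots,x_n]$ by permuting the variables. Write $\partial_i=\partial/\partial x_i$. For $q\in\mathbb C$ and $k\ge 1$ put $$D_{k;q}=q\sum_{i=1}^n x_i\,\partial_i^{\,k+1}+\sum_{i=1}^n\partial_i^{\,k},$$ and let $\mathcal H_q=\{f\in\mathbb C[x_1,\dots,x_n] : D_{k;q}f=0\text{ for all }k\ge 1\}$ be the space of $q$-harmonics. It is a graded $\mathfrak S_n$-module, and $\mathcal H_0$ is the space of classical $\mathfrak S_n$-harmonics. Let $\pi_d(\mathcal H_q)$ denote its homogeneous component of degree $d$, let $$F_{n;q}(t)=\sum_{d\ge 0}t^d\,\frac1{n!}\sum_{\sigma\in\mathfrak S_n}\chi_{\pi_d(\mathcal H_q)}(\sigma)\,p_{\lambda(\sigma)}$$ be its graded Frobenius characteristic, where $\chi_V$ is the character of $V$, $\lambda(\sigma)$ is the cycle type of $\sigma$ and $p_\lambda$ is the power sum symmetric function. Call $q_0\in\mathbb C$ singular if $F_{n;q_0}(t)\ne F_{n;0}(t)$. Then every number of the form $q_0=-a/b$ with $a\in\{1,\dots,n\}$,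 $b\in\mathbb N$ and $b\ge n$ is singular ($a$ and $b$ need not be coprime). -/

import Mathlib

namespace QHarmonics

noncomputable section

open MvPolynomial

/-- `∇ₖ = ∑ᵢ ∂ᵢᵏ`, acting on `ℂ[x₁, …, xₙ]`. -/
def nabla (n k : ℕ) : Module.End ℂ (MvPolynomial (Fin n) ℂ) :=
  ∑ i : Fin n, (pderiv i).toLinearMap ^ k

/-- `D̃ₖ = ∑ᵢ xᵢ ∂ᵢᵏ⁺¹`, acting on `ℂ[x₁, …, xₙ]`. -/
def dTilde (n k : ℕ) : Module.End ℂ (MvPolynomial (Fin n) ℂ) :=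
  ∑ i : Fin n, LinearMap.mulLeft ℂ (X i) * (pderiv i).toLinearMap ^ (k + 1)

/-- `D_{k;q} = q D̃ₖ + ∇ₖ`. -/
def dOp (n : ℕ) (q : ℂ) (k : ℕ) : Module.End ℂ (MvPolynomial (Fin n) ℂ) :=
  q • dTilde n k + nabla n k

/-- The space of `q`-harmonics: the polynomials killed by every `D_{k;q}` with `k ≥ 1`. For `q = 0`
these are the classical `𝔖ₙ`-harmonics. -/
def harmonics (n : ℕ) (q : ℂ) : Submodule ℂ (MvPolynomial (Fin n) ℂ) where
  carrier := {f | ∀ k, 1 ≤ k → dOp n q k f = 0}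
  add_mem' hf hg k hk := by rw [map_add, hf k hk, hg k hk, add_zero]
  zero_mem' k _ := map_zero _
  smul_mem' c f hf k hk := by rw [map_smul, hf k hk, smul_zero]

/-- For `q = 0` the defining equations are those of the classical `𝔖ₙ`-harmonics. -/
theorem mem_harmonics_zero {n : ℕ} {f : MvPolynomial (Fin n) ℂ} :
    f ∈ harmonics n 0 ↔ ∀ k, 1 ≤ k → nabla n k f = 0 := by
  change (∀ k, 1 ≤ k → dOp n 0 k f = 0) ↔ _
  simp [dOp]

/-- The action of `𝔖ₙ` on `ℂ[x₁, …, xₙ]` by permutation of the variables, `σ · xᵢ = x_{σ(i)}`. -/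
def permRep (n : ℕ) :
    Representation ℂ (Equiv.Perm (Fin n)) (MvPolynomial (Fin n) ℂ) where
  toFun σ := (rename σ).toLinearMap
  map_one' := by
    refine LinearMap.ext fun f => ?_
    simp
  map_mul' σ τ := by
    refine LinearMap.ext fun f => ?_
    simp [rename_rename]

theorem pderiv_pow_permRep {n : ℕ} (σ : Equiv.Perm (Fin n)) (i : Fin n) (k : ℕ)
    (f : MvPolynomial (Fin n) ℂ) :
    ((pderiv (σ i)).toLinearMap ^ k : Module.End ℂ (MvPolynomial (Fin n) ℂ)) (permRep n σ f) =
      permRep n σ (((pderiv i).toLinearMap ^ k : Module.End ℂ (MvPolynomial (Fin n) ℂ)) f) := by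
  induction k with
  | zero => simp
  | succ k ih =>
    rw [pow_succ', pow_succ', Module.End.mul_apply, Module.End.mul_apply, ih]
    exact pderiv_rename σ.injective i _

/-- The operators `D_{k;q}` commute with permutations of the variables. -/
theorem dOp_permRep {n : ℕ} (q : ℂ) (k : ℕ) (σ : Equiv.Perm (Fin n))
    (f : MvPolynomial (Fin n) ℂ) :
    dOp n q k (permRep n σ f) = permRep n σ (dOp n q k f) := by
  have h1 : nabla n k (permRep n σ f) = permRep n σ (nabla n k f) := by
    simp only [nabla, LinearMap.sum_apply, map_sum]
    rw [← Equiv.sum_comp σ]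
    exact Finset.sum_congr rfl fun i _ => pderiv_pow_permRep σ i k f
  have h2 : dTilde n k (permRep n σ f) = permRep n σ (dTilde n k f) := by
    simp only [dTilde, LinearMap.sum_apply, map_sum]
    rw [← Equiv.sum_comp σ]
    refine Finset.sum_congr rfl fun i _ => ?_
    rw [Module.End.mul_apply, Module.End.mul_apply, pderiv_pow_permRep]
    simp [permRep]
  simp [dOp, h1, h2]

/-- The homogeneous component of degree `d` of the space of `q`-harmonics, as a subrepresentation
of `ℂ[x₁, …, xₙ]`. -/
def gradedPiece (n : ℕ) (q : ℂ) (d : ℕ) : Subrepresentation (permRep n) where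
  toSubmodule := harmonics n q ⊓ homogeneousSubmodule (Fin n) ℂ d
  apply_mem_toSubmodule σ f hf := by
    refine ⟨fun k hk => ?_, ?_⟩
    · rw [dOp_permRep, hf.1 k hk, map_zero]
    · exact IsHomogeneous.rename_isHomogeneous hf.2

/-- The power sum symmetric function `pₖ = x₀ᵏ + x₁ᵏ + x₂ᵏ + ⋯` (for `k ≥ 1`), in infinitely many
variables, as a formal power series of bounded degree. -/
def powerSum (k : ℕ) : MvPowerSeries ℕ ℂ :=
  open Classical in fun m => if ∃ i : ℕ, m = Finsupp.single i k then 1 else 0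

/-- The Frobenius characteristic
`(1 / n!) ∑_{σ ∈ 𝔖ₙ} χ(σ) p_{λ(σ)}` of a (finite-dimensional) complex representation of `𝔖ₙ` with
character `χ`, where `λ(σ)` is the cycle type of `σ` (fixed points included) and
`p_λ = p_{λ₁} p_{λ₂} ⋯`. -/
def frobenius {n : ℕ} {V : Type*} [AddCommGroup V] [Module ℂ V]
    (ρ : Representation ℂ (Equiv.Perm (Fin n)) V) : MvPowerSeries ℕ ℂ :=
  (n.factorial : ℂ)⁻¹ • ∑ σ : Equiv.Perm (Fin n),
    ρ.character σ • (σ.partition.parts.map powerSum).prod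

/-- The graded Frobenius characteristic `F_{n;q}(t) = ∑_d tᵈ Frob(π_d(𝓗_q))` of the
`q`-harmonics. -/
def gradedFrobenius (n : ℕ) (q : ℂ) : PowerSeries (MvPowerSeries ℕ ℂ) :=
  PowerSeries.mk fun d => frobenius (gradedPiece n q d).toRepresentation

/-- `q` is singular (for `n` variables) if the graded Frobenius characteristic of the `q`-harmonics
differs from that of the classical harmonics. -/
def IsSingular (n : ℕ) (q : ℂ) : Prop :=
  gradedFrobenius n q ≠ gradedFrobenius n 0

end

end QHarmonics

/-! Invariants of a point stabilizer `𝔖ₙ₋₁` separate the two modules in degree `b`.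

A classical harmonic `f` is annihilated by every `g(∂)` with `g` in the ideal generated by the power
sums. That ideal contains `xᵢⁿ`, so `f` has no term `xᵢᵈ` with `d ≥ n`. If `f` is also fixed by the
stabilizer of `i`, the relations `∇ₖ f = 0` propagate this vanishing to all coefficients
(`eq_zero_of_harmonic_of_invariant`).

For `|A| = a ≥ 2` and `i, j ∈ A`, the polynomial `(xᵢ - xⱼ)(∑_{l ∈ A} xₗ)^(b-1)` is `q`-harmonic for
`q = -a/b` and contains `xᵢᵇ`. Averaging over the stabilizer of `i` keeps this term, giving a
nonzero invariant. The Frobenius characteristic sees such invariants in its coefficient of `x₀ⁿ⁻¹x₁`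
(`coeff_frobenius_eq_zero_iff`). The case `a = 1` reduces to `a = 2`. -/

namespace QHarmonics

open MvPolynomial

/-! ### Apolarity and classical harmonics -/

/-- The coefficient `m! · [xᵐ] f`, i.e. the constant term of `∂ᵐ f`. -/
noncomputable def facCoeff {n : ℕ} (m : Fin n →₀ ℕ) : MvPolynomial (Fin n) ℂ →ₗ[ℂ] ℂ :=
  ((∏ i, (m i).factorial : ℕ) : ℂ) • lcoeff ℂ m

theorem facCoeff_apply {n : ℕ} (m : Fin n →₀ ℕ) (f : MvPolynomial (Fin n) ℂ) :
    facCoeff m f = ((∏ i, (m i).factorial : ℕ) : ℂ) * coeff m f := rfl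

theorem facCoeff_eq_zero_iff {n : ℕ} {m : Fin n →₀ ℕ} {f : MvPolynomial (Fin n) ℂ} :
    facCoeff m f = 0 ↔ coeff m f = 0 := by
  have h : ((∏ i, (m i).factorial : ℕ) : ℂ) ≠ 0 :=
    Nat.cast_ne_zero.2 (Finset.prod_ne_zero_iff.2 fun i _ => Nat.factorial_ne_zero _)
  rw [facCoeff_apply, mul_eq_zero, or_iff_right h]

theorem facCoeff_pderiv {n : ℕ} (m : Fin n →₀ ℕ) (i : Fin n) (f : MvPolynomial (Fin n) ℂ) :
    facCoeff m (pderiv i f) = facCoeff (m + Finsupp.single i 1) f := by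
  have h : ∏ j, ((m + Finsupp.single i 1 : Fin n →₀ ℕ) j).factorial =
      (∏ j, (m j).factorial) * (m i + 1) := by
    rw [← Finset.mul_prod_erase _ _ (Finset.mem_univ i),
      ← Finset.mul_prod_erase _ (fun j => (m j).factorial) (Finset.mem_univ i)]
    have h' : ∏ j ∈ Finset.univ.erase i, ((m + Finsupp.single i 1 : Fin n →₀ ℕ) j).factorial =
        ∏ j ∈ Finset.univ.erase i, (m j).factorial :=
      Finset.prod_congr rfl fun j hj => by
        simp [Finsupp.single_eq_of_ne (Finset.ne_of_mem_erase hj)]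
    rw [h']
    simp [Nat.factorial_succ]
    ring
  rw [facCoeff_apply, facCoeff_apply, coeff_pderiv, h]
  push_cast
  ring

theorem facCoeff_pderiv_pow {n : ℕ} (m : Fin n →₀ ℕ) (i : Fin n) (k : ℕ)
    (f : MvPolynomial (Fin n) ℂ) :
    facCoeff m (((pderiv i).toLinearMap ^ k : Module.End ℂ (MvPolynomial (Fin n) ℂ)) f) =
      facCoeff (m + Finsupp.single i k) f := by
  induction k generalizing m with
  | zero => simp
  | succ k ih =>
    rw [pow_succ', Module.End.mul_apply]
    refine (facCoeff_pderiv m i _).trans ?_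
    rw [ih, add_assoc, ← Finsupp.single_add, add_comm 1 k]

theorem facCoeff_nabla {n : ℕ} (m : Fin n →₀ ℕ) (k : ℕ) (f : MvPolynomial (Fin n) ℂ) :
    facCoeff m (nabla n k f) = ∑ i, facCoeff (m + Finsupp.single i k) f := by
  simp only [nabla, LinearMap.sum_apply, map_sum, facCoeff_pderiv_pow]

/-- The functional `g ↦ (g(∂) f)(0)`. -/
noncomputable def apolar {n : ℕ} (f : MvPolynomial (Fin n) ℂ) : MvPolynomial (Fin n) ℂ →ₗ[ℂ] ℂ :=
  (basisMonomials (Fin n) ℂ).constr ℂ fun m => facCoeff m f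

theorem apolar_monomial {n : ℕ} (f : MvPolynomial (Fin n) ℂ) (m : Fin n →₀ ℕ) :
    apolar f (monomial m 1) = facCoeff m f := by
  have := (basisMonomials (Fin n) ℂ).constr_basis ℂ (fun m => facCoeff m f) m
  rwa [coe_basisMonomials] at this

/-- The ideal of the constant-coefficient differential operators `g(∂)` annihilating `f`. -/
noncomputable def annIdeal {n : ℕ} (f : MvPolynomial (Fin n) ℂ) :
    Ideal (MvPolynomial (Fin n) ℂ) where
  carrier := {g | ∀ h, apolar f (h * g) = 0}
  add_mem' hg hg' h := by rw [mul_add, map_add, hg h, hg' h, add_zero]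
  zero_mem' h := by simp
  smul_mem' c g hg h := by rw [smul_eq_mul, ← mul_assoc]; exact hg _

theorem psum_mem_annIdeal {n : ℕ} {f : MvPolynomial (Fin n) ℂ} (hf : f ∈ harmonics n 0) {k : ℕ}
    (hk : 1 ≤ k) : psum (Fin n) ℂ k ∈ annIdeal f := by
  intro h
  induction h using MvPolynomial.induction_on' with
  | monomial u a =>
    have h : monomial u a * psum (Fin n) ℂ k =
        a • ∑ i, monomial (u + Finsupp.single i k) (1 : ℂ) := by
      simp only [psum, Finset.mul_sum, Finset.smul_sum, X_pow_eq_monomial, monomial_mul,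
        smul_monomial, mul_one, smul_eq_mul]
    rw [h, map_smul, map_sum]
    simp only [apolar_monomial]
    rw [← facCoeff_nabla, mem_harmonics_zero.1 hf k hk, map_zero, smul_zero]
  | add p q hp hq => rw [add_mul, map_add, hp, hq, add_zero]

/-- Newton's identities, with division by `k` in characteristic zero. -/
theorem esymm_mem_of_psum_mem {n : ℕ} (I : Ideal (MvPolynomial (Fin n) ℂ))
    (hI : ∀ k, 1 ≤ k → psum (Fin n) ℂ k ∈ I) {k : ℕ} (hk : 1 ≤ k) : esymm (Fin n) ℂ k ∈ I := by
  have h : (k : MvPolynomial (Fin n) ℂ) * esymm (Fin n) ℂ k ∈ I := by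
    rw [mul_esymm_eq_sum]
    refine I.mul_mem_left _ (I.sum_mem fun a ha => I.mul_mem_left _ (hI _ ?_))
    rw [Finset.mem_filter, Finset.HasAntidiagonal.mem_antidiagonal] at ha
    have := ha.2
    omega
  have h' := I.mul_mem_left (C ((k : ℂ)⁻¹)) h
  have hk' : (k : ℂ) ≠ 0 := Nat.cast_ne_zero.2 (by omega)
  rwa [← mul_assoc, ← map_natCast (C : ℂ →+* MvPolynomial (Fin n) ℂ), ← map_mul,
    inv_mul_cancel₀ hk', map_one, one_mul] at h'

/-- Evaluating `∏ⱼ (T + xⱼ) = ∑ₖ eₖ Tⁿ⁻ᵏ` at `T = -xᵢ` gives zero, and all terms with `k ≥ 1` lie in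
`I`. -/
theorem X_pow_mem_of_psum_mem {n : ℕ} (I : Ideal (MvPolynomial (Fin n) ℂ))
    (hI : ∀ k, 1 ≤ k → psum (Fin n) ℂ k ∈ I) (i : Fin n) : X i ^ n ∈ I := by
  have h := congrArg (Polynomial.eval (-X i)) (prod_C_add_X_eq_sum_esymm (σ := Fin n) (R := ℂ))
  rw [Polynomial.eval_prod, Finset.prod_eq_zero (Finset.mem_univ i) (by simp),
    Polynomial.eval_finsetSum, Fintype.card_fin, Finset.sum_range_succ'] at h
  simp only [Polynomial.eval_mul, Polynomial.eval_C, Polynomial.eval_pow, Polynomial.eval_X,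
    esymm_zero, one_mul, Nat.sub_zero] at h
  have h2 : (-X i : MvPolynomial (Fin n) ℂ) ^ n ∈ I := by
    rw [← (I.add_mem_iff_right (a := ∑ k ∈ Finset.range n, esymm (Fin n) ℂ (k + 1) *
      (-X i) ^ (n - (k + 1))) (I.sum_mem fun k _ => I.mul_mem_right _
        (esymm_mem_of_psum_mem I hI (by omega)))), ← h]
    exact I.zero_mem
  rw [neg_pow] at h2
  have h3 := I.mul_mem_left ((-1) ^ n) h2
  rwa [← mul_assoc, ← mul_pow, neg_one_mul, neg_neg, one_pow, one_mul] at h3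

theorem facCoeff_single_eq_zero {n : ℕ} {f : MvPolynomial (Fin n) ℂ} (hf : f ∈ harmonics n 0)
    (i : Fin n) {k : ℕ} (hk : n ≤ k) : facCoeff (Finsupp.single i k) f = 0 := by
  have h := X_pow_mem_of_psum_mem (annIdeal f) (fun k hk => psum_mem_annIdeal hf hk) i
    (X i ^ (k - n))
  rwa [← pow_add, Nat.sub_add_cancel hk, X_pow_eq_monomial, apolar_monomial] at h

theorem facCoeff_rename_invariant {n : ℕ} {f : MvPolynomial (Fin n) ℂ} {σ : Equiv.Perm (Fin n)}
    (hσ : permRep n σ f = f) (m : Fin n →₀ ℕ) :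
    facCoeff (m.mapDomain σ) f = facCoeff m f := by
  have h : ∏ i, ((m.mapDomain σ) i).factorial = ∏ i, (m i).factorial := by
    rw [← Equiv.prod_comp σ]
    simp [Finsupp.mapDomain_apply σ.injective]
  rw [facCoeff_apply, facCoeff_apply, h, ← coeff_rename_mapDomain σ σ.injective f m]
  congr 2
  exact hσ.symm

/-- Classical harmonics of degree at least `n` have no nonzero vector fixed by the stabilizer of a
variable. -/
theorem eq_zero_of_harmonic_of_invariant {n d : ℕ} (hd : n ≤ d) (i₀ : Fin n)
    {f : MvPolynomial (Fin n) ℂ} (hf : f ∈ harmonics n 0) (hhom : f.IsHomogeneous d)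
    (hinv : ∀ σ : Equiv.Perm (Fin n), σ i₀ = i₀ → permRep n σ f = f) : f = 0 := by
  -- Strong induction on the number of variables other than `x_{i₀}` occurring in `xᵐ`.
  have key : ∀ s (m : Fin n →₀ ℕ), (m.support.erase i₀).card = s → facCoeff m f = 0 := by
    intro s
    induction s using Nat.strong_induction_on with
    | _ s ih =>
      intro m hm
      rcases (m.support.erase i₀).eq_empty_or_nonempty with h0 | ⟨j, hj⟩
      · have hm' : m = Finsupp.single i₀ (m i₀) := by
          rw [← Finsupp.support_subset_singleton]
          rwa [Finset.erase_eq_empty_iff, ← Finset.subset_singleton_iff] at h0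
        by_cases hdeg : m i₀ = d
        · rw [hm']
          exact facCoeff_single_eq_zero hf i₀ (by omega)
        · rw [facCoeff_eq_zero_iff]
          refine hhom.coeff_eq_zero ?_
          rw [hm', Finsupp.degree_single]
          exact hdeg
      · have hji : j ≠ i₀ := Finset.ne_of_mem_erase hj
        have hmj : m j ≠ 0 := Finsupp.mem_support_iff.1 (Finset.mem_of_mem_erase hj)
        set ν := m.erase j with hν
        have hνm : ν + Finsupp.single j (m j) = m := Finsupp.erase_add_single j m
        have hsum : ∑ i, facCoeff (ν + Finsupp.single i (m j)) f = 0 := by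
          rw [← facCoeff_nabla, mem_harmonics_zero.1 hf _ (Nat.one_le_iff_ne_zero.2 hmj), map_zero]
        -- Moving the exponent of `xⱼ` onto `x_{i₀}` or a variable already present lowers the count;
        -- moving it onto a fresh variable gives the image of `m` under a transposition fixing `i₀`.
        have hterm : ∀ i, facCoeff (ν + Finsupp.single i (m j)) f =
            if i ∈ insert i₀ ν.support then 0 else facCoeff m f := by
          intro i
          split_ifs with hi
          · refine ih _ ?_ _ rfl
            rw [← hm]
            refine Finset.card_lt_card ⟨?_, fun hsub => ?_⟩
            · intro l hl
              simp only [Finset.mem_erase, Finsupp.mem_support_iff, Finsupp.add_apply, ne_eq,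
                Finset.mem_insert, hν, Finsupp.erase_apply, Finsupp.single_apply] at hl hi ⊢
              grind
            · have := hsub hj
              simp only [Finset.mem_erase, Finsupp.mem_support_iff, Finsupp.add_apply, ne_eq,
                Finset.mem_insert, hν, Finsupp.erase_apply, Finsupp.single_apply] at this hi
              grind
          · rw [← facCoeff_rename_invariant (σ := Equiv.swap i j) (hinv _ ?_) m]
            · refine congrArg (fun m => facCoeff m f) (Finsupp.ext fun l => ?_)
              rw [Finsupp.mapDomain_equiv_apply, Equiv.symm_swap, hν]
              simp only [Finset.mem_insert, hν, Finsupp.mem_support_iff, Finsupp.erase_apply,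
                Finsupp.add_apply, Finsupp.single_apply] at hi ⊢
              rcases eq_or_ne l i with rfl | hli
              · rw [Equiv.swap_apply_left]
                grind
              rcases eq_or_ne l j with rfl | hlj
              · rw [Equiv.swap_apply_right]
                grind
              · rw [Equiv.swap_apply_of_ne_of_ne hli hlj]
                grind
            · simp only [Finset.mem_insert, not_or] at hi
              exact Equiv.swap_apply_of_ne_of_ne (Ne.symm hi.1) hji.symm
        simp only [hterm, Finset.sum_ite, Finset.sum_const_zero, zero_add, Finset.sum_const,
          nsmul_eq_mul, mul_eq_zero, Nat.cast_eq_zero] at hsum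
        -- The multiplicity of `facCoeff m f` is nonzero because `i = j` is itself counted.
        refine hsum.resolve_left fun h => ?_
        rw [Finset.card_eq_zero, Finset.filter_eq_empty_iff] at h
        exact h (Finset.mem_univ j) (by simp [hν, hji])
  ext m
  rw [MvPolynomial.coeff_zero, ← facCoeff_eq_zero_iff]
  exact key _ m rfl

/-! ### Stabilizer invariants in the Frobenius characteristic -/

theorem coeff_powerSum_mul {k : ℕ} (hk : 1 ≤ k) (m : ℕ →₀ ℕ) (F : MvPowerSeries ℕ ℂ) :
    MvPowerSeries.coeff m (powerSum k * F) =
      ∑ i ∈ m.support, if k ≤ m i then MvPowerSeries.coeff (m - Finsupp.single i k) F else 0 := by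
  classical
  have hcoeff : ∀ p ∈ Finset.HasAntidiagonal.antidiagonal m,
      MvPowerSeries.coeff p.1 (powerSum k) =
        ∑ i ∈ m.support, if p.1 = Finsupp.single i k then (1 : ℂ) else 0 := by
    intro p hp
    rw [Finset.HasAntidiagonal.mem_antidiagonal] at hp
    change (if ∃ i : ℕ, p.1 = Finsupp.single i k then (1 : ℂ) else 0) = _
    split_ifs with h
    · obtain ⟨i, hi⟩ := h
      rw [Finset.sum_eq_single_of_mem i, if_pos hi]
      · have := DFunLike.congr_fun hp i
        simp only [hi, Finsupp.add_apply, Finsupp.single_eq_same] at this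
        rw [Finsupp.mem_support_iff]
        omega
      · intro j _ hj
        refine if_neg fun h' => hj ?_
        rw [hi] at h'
        exact (Finsupp.single_left_injective (by omega : k ≠ 0) h').symm
    · exact (Finset.sum_eq_zero fun i _ => if_neg fun h' => h ⟨i, h'⟩).symm
  rw [MvPowerSeries.coeff_mul, Finset.sum_congr rfl fun p hp => by rw [hcoeff p hp]]
  simp only [Finset.sum_mul]
  rw [Finset.sum_comm]
  refine Finset.sum_congr rfl fun i _ => ?_
  have hX : ∀ p : (ℕ →₀ ℕ) × (ℕ →₀ ℕ), (if p.1 = Finsupp.single i k then (1 : ℂ) else 0) =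
      MvPowerSeries.coeff p.1 (MvPowerSeries.monomial (Finsupp.single i k) (1 : ℂ)) := fun p => by
    rw [MvPowerSeries.coeff_monomial]
  simp only [hX]
  rw [← MvPowerSeries.coeff_mul, MvPowerSeries.coeff_monomial_mul]
  simp

/-- Each part is assigned to one variable. For `x₀ᴺx₁` exactly one part goes to `x₁`, and it must be
a `1`; the first claim handles the remaining parts, all assigned to `x₀`. -/
theorem coeff_prod_powerSum (s : Multiset ℕ) (hs : ∀ k ∈ s, 1 ≤ k) :
    (∀ N, s.sum = N → MvPowerSeries.coeff (Finsupp.single 0 N) (s.map powerSum).prod = 1) ∧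
    (∀ N, s.sum = N + 1 → MvPowerSeries.coeff (Finsupp.single 0 N + Finsupp.single 1 1)
      (s.map powerSum).prod = (s.count 1 : ℂ)) := by
  induction s using Multiset.induction_on with
  | empty =>
    refine ⟨fun N hN => ?_, fun N hN => by simp at hN⟩
    rw [Multiset.sum_zero] at hN
    simp [← hN]
  | cons k s ih =>
    obtain ⟨ih1, ih2⟩ := ih fun l hl => hs l (Multiset.mem_cons_of_mem hl)
    have hk := hs k (Multiset.mem_cons_self k s)
    constructor
    · intro N hN
      rw [Multiset.sum_cons] at hN
      rw [Multiset.map_cons, Multiset.prod_cons, coeff_powerSum_mul hk,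
        Finsupp.support_single _ (by omega), Finset.sum_singleton, Finsupp.single_eq_same,
        if_pos (by omega), ← Finsupp.single_tsub]
      exact ih1 _ (by omega)
    · intro N hN
      rw [Multiset.sum_cons] at hN
      have hsub : (Finsupp.single 0 N + Finsupp.single 1 1 : ℕ →₀ ℕ).support ⊆ {0, 1} := by
        intro i
        simp only [Finsupp.mem_support_iff, Finsupp.add_apply, Finsupp.single_apply,
          Finset.mem_insert, Finset.mem_singleton]
        grind
      rw [Multiset.map_cons, Multiset.prod_cons, coeff_powerSum_mul hk,
        Finset.sum_subset hsub fun i _ hi => if_neg ?_, Finset.sum_pair zero_ne_one]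
      · have e0 : (Finsupp.single 0 N + Finsupp.single 1 1 : ℕ →₀ ℕ) 0 = N := by simp
        have e1 : (Finsupp.single 0 N + Finsupp.single 1 1 : ℕ →₀ ℕ) 1 = 1 := by simp
        rw [e0, e1, Multiset.count_cons, Nat.cast_add]
        congr 1
        · split_ifs with h
          · have : (Finsupp.single 0 N + Finsupp.single 1 1 - Finsupp.single 0 k : ℕ →₀ ℕ) =
                Finsupp.single 0 (N - k) + Finsupp.single 1 1 := by
              refine Finsupp.ext fun l => ?_
              simp only [Finsupp.tsub_apply, Finsupp.add_apply, Finsupp.single_apply]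
              grind
            rw [this]
            exact ih2 _ (by omega)
          -- Here `k = N + 1` exhausts the sum.
          · have h0 : s = 0 := by
              refine Multiset.eq_zero_of_forall_notMem fun l hl => ?_
              have := hs l (Multiset.mem_cons_of_mem hl)
              have := Multiset.le_sum_of_mem hl
              omega
            simp [h0]
        · rcases eq_or_ne k 1 with rfl | h1
          · rw [if_pos le_rfl, if_pos rfl, add_tsub_cancel_right, Nat.cast_one]
            exact ih1 _ (by omega)
          · rw [if_neg (by omega), if_neg h1.symm, Nat.cast_zero]
      · rw [Finsupp.notMem_support_iff.1 hi]
        omega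

theorem count_one_parts_partition {n : ℕ} (σ : Equiv.Perm (Fin n)) :
    σ.partition.parts.count 1 = (Finset.univ.filter fun i => σ i = i).card := by
  have h0 : σ.cycleType.count 1 = 0 := Multiset.count_eq_zero.2 fun h => by
    have := Equiv.Perm.two_le_of_mem_cycleType h
    omega
  rw [Equiv.Perm.parts_partition, Multiset.count_add, h0, Multiset.count_replicate_self, zero_add,
    ← Finset.card_compl]
  congr 1
  ext i
  simp

theorem coeff_prod_powerSum_partition {n : ℕ} (hn : 1 ≤ n) (σ : Equiv.Perm (Fin n)) :
    MvPowerSeries.coeff (Finsupp.single 0 (n - 1) + Finsupp.single 1 1)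
      (σ.partition.parts.map powerSum).prod =
      ((Finset.univ.filter fun i => σ i = i).card : ℂ) := by
  rw [(coeff_prod_powerSum _ fun k hk => σ.partition.parts_pos hk).2 (n - 1) ?_,
    count_one_parts_partition]
  rw [σ.partition.parts_sum, Fintype.card_fin]
  omega

/-- The space of vectors fixed by the stabilizer of a point. -/
noncomputable def stabInvariants {n : ℕ} {V : Type*} [AddCommGroup V] [Module ℂ V]
    (ρ : Representation ℂ (Equiv.Perm (Fin n)) V) (i : Fin n) : Submodule ℂ V :=
  Representation.invariants (ρ.comp (MulAction.stabilizer (Equiv.Perm (Fin n)) i).subtype)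

theorem mem_stabInvariants {n : ℕ} {V : Type*} [AddCommGroup V] [Module ℂ V]
    {ρ : Representation ℂ (Equiv.Perm (Fin n)) V} {i : Fin n} {v : V} :
    v ∈ stabInvariants ρ i ↔ ∀ σ : Equiv.Perm (Fin n), σ i = i → ρ σ v = v :=
  ⟨fun h σ hσ => h ⟨σ, hσ⟩, fun h σ => h σ.1 σ.2⟩

theorem sum_character_stabilizer {n : ℕ} {V : Type*} [AddCommGroup V] [Module ℂ V]
    [Module.Finite ℂ V] (ρ : Representation ℂ (Equiv.Perm (Fin n)) V) (i : Fin n) :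
    ∑ σ : Equiv.Perm (Fin n) with σ i = i, ρ.character σ =
      ((Nat.card (MulAction.stabilizer (Equiv.Perm (Fin n)) i) *
        Module.finrank ℂ (stabInvariants ρ i) : ℕ) : ℂ) := by
  classical
  have hc : (Nat.card (MulAction.stabilizer (Equiv.Perm (Fin n)) i) : ℂ) ≠ 0 :=
    Nat.cast_ne_zero.2 Nat.card_pos.ne'
  have := Fintype.ofFinite (MulAction.stabilizer (Equiv.Perm (Fin n)) i)
  have : Invertible (Nat.card (MulAction.stabilizer (Equiv.Perm (Fin n)) i) : ℂ) :=
    invertibleOfNonzero hc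
  have h := Representation.card_inv_mul_sum_char_eq_finrank
    (ρ.comp (MulAction.stabilizer (Equiv.Perm (Fin n)) i).subtype)
  rw [Nat.cast_mul, stabInvariants, ← h, mul_inv_cancel_left₀ hc]
  refine Finset.sum_subtype _ (fun σ => ?_) _
  simp [MulAction.mem_stabilizer_iff]

/-- Exchange the sums over pairs `(σ, i)` with `σ i = i`. Keeping the sum over `i` avoids any
conjugacy argument: its terms are natural numbers, so it vanishes only termwise. -/
theorem coeff_frobenius {n : ℕ} (hn : 1 ≤ n) {V : Type*} [AddCommGroup V] [Module ℂ V]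
    [Module.Finite ℂ V] (ρ : Representation ℂ (Equiv.Perm (Fin n)) V) :
    MvPowerSeries.coeff (Finsupp.single 0 (n - 1) + Finsupp.single 1 1) (frobenius ρ) =
      (n.factorial : ℂ)⁻¹ *
        ((∑ i : Fin n, Nat.card (MulAction.stabilizer (Equiv.Perm (Fin n)) i) *
          Module.finrank ℂ (stabInvariants ρ i) : ℕ) : ℂ) := by
  rw [Nat.cast_sum]
  simp only [← sum_character_stabilizer, frobenius, map_smul, map_sum, smul_eq_mul,
    coeff_prod_powerSum_partition hn, Finset.sum_filter]
  rw [Finset.sum_comm]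
  congr 1
  refine Finset.sum_congr rfl fun σ _ => ?_
  rw [← Finset.sum_filter, Finset.sum_const, nsmul_eq_mul, mul_comm]

theorem coeff_frobenius_eq_zero_iff {n : ℕ} (hn : 1 ≤ n) {V : Type*} [AddCommGroup V] [Module ℂ V]
    [Module.Finite ℂ V] (ρ : Representation ℂ (Equiv.Perm (Fin n)) V) :
    MvPowerSeries.coeff (Finsupp.single 0 (n - 1) + Finsupp.single 1 1) (frobenius ρ) = 0 ↔
      ∀ i, stabInvariants ρ i = ⊥ := by
  have hn' : (n.factorial : ℂ)⁻¹ ≠ 0 := inv_ne_zero (Nat.cast_ne_zero.2 n.factorial_ne_zero)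
  rw [coeff_frobenius hn, mul_eq_zero, or_iff_right hn', Nat.cast_eq_zero, Finset.sum_eq_zero_iff]
  simp only [Finset.mem_univ, true_implies, mul_eq_zero, Nat.card_pos.ne', false_or,
    Submodule.finrank_eq_zero]

instance finite_gradedPiece (n : ℕ) (q : ℂ) (d : ℕ) :
    Module.Finite ℂ (gradedPiece n q d).toSubmodule :=
  have : Module.Finite ℂ (homogeneousSubmodule (Fin n) ℂ d) :=
    Module.Finite.iff_fg.2 (homogeneousSubmodule_fg _ _ d)
  Submodule.finiteDimensional_of_le
    (inf_le_right : (gradedPiece n q d).toSubmodule ≤ homogeneousSubmodule (Fin n) ℂ d)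

/-! ### Criterion for singularity -/

/-- If a `q`-harmonic of degree `d ≥ n` contains the monomial `xᵢᵈ`, then `q` is singular. -/
theorem isSingular_of_coeff_ne_zero {n d : ℕ} {q : ℂ} (hn : 1 ≤ n) (hd : n ≤ d) (i : Fin n)
    {f : MvPolynomial (Fin n) ℂ} (hf : f ∈ harmonics n q) (hhom : f.IsHomogeneous d)
    (hcoeff : coeff (Finsupp.single i d) f ≠ 0) : IsSingular n q := by
  intro heq
  have h0 : ∀ i, stabInvariants (gradedPiece n 0 d).toRepresentation i = ⊥ := fun j => by
    rw [eq_bot_iff]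
    intro v hv
    rw [mem_stabInvariants] at hv
    exact Subtype.ext (eq_zero_of_harmonic_of_invariant hd j v.2.1 v.2.2 fun σ hσ =>
      congrArg Subtype.val (hv σ hσ))
  have hd' : frobenius (gradedPiece n q d).toRepresentation =
      frobenius (gradedPiece n 0 d).toRepresentation := by
    simpa [gradedFrobenius] using congrArg (PowerSeries.coeff d) heq
  rw [← coeff_frobenius_eq_zero_iff hn, ← hd', coeff_frobenius_eq_zero_iff hn] at h0
  set g : (gradedPiece n q d).toSubmodule :=
    ∑ σ : Equiv.Perm (Fin n) with σ i = i, (gradedPiece n q d).toRepresentation σ ⟨f, hf, hhom⟩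
  have hg : g ∈ stabInvariants (gradedPiece n q d).toRepresentation i := by
    rw [mem_stabInvariants]
    intro τ hτ
    rw [map_sum]
    refine Finset.sum_equiv (Equiv.mulLeft τ) (fun σ => ?_) fun σ _ => ?_
    · simp only [Finset.mem_filter, Finset.mem_univ, true_and, Equiv.coe_mulLeft,
        Equiv.Perm.mul_apply]
      conv_rhs => rw [← hτ, τ.injective.eq_iff, hτ]
    · rw [Equiv.coe_mulLeft, map_mul, Module.End.mul_apply]
  rw [h0 i, Submodule.mem_bot] at hg
  have hg' := congrArg (fun v : (gradedPiece n q d).toSubmodule =>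
    coeff (Finsupp.single i d) (v : MvPolynomial (Fin n) ℂ)) hg
  simp only [g, AddSubmonoidClass.coe_finsetSum, coeff_sum, ZeroMemClass.coe_zero,
    coeff_zero] at hg'
  -- Permutations fixing `i` preserve the coefficient of `xᵢᵈ`, so the sum multiplies it by the
  -- order of the stabilizer.
  rw [Finset.sum_congr rfl (g := fun _ => coeff (Finsupp.single i d) f), Finset.sum_const,
    nsmul_eq_mul, mul_eq_zero, or_iff_left hcoeff, Nat.cast_eq_zero, Finset.card_eq_zero,
    Finset.filter_eq_empty_iff] at hg'
  · exact hg' (Finset.mem_univ 1) rfl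
  · intro σ hσ
    rw [Finset.mem_filter] at hσ
    have := coeff_rename_mapDomain σ σ.injective f (Finsupp.single i d)
    rwa [Finsupp.mapDomain_single, hσ.2] at this

/-! ### Explicit `q`-harmonics -/

theorem pderiv_sum_X {n : ℕ} (A : Finset (Fin n)) (i : Fin n) :
    pderiv i (∑ j ∈ A, X j : MvPolynomial (Fin n) ℂ) = if i ∈ A then 1 else 0 := by
  simp [map_sum, pderiv_X, Pi.single_apply]

/-- Leibniz has only two terms since `∂ᵢ l` is constant. Truncated subtraction is harmless: the
factor `k` or a falling factorial vanishes there. -/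
theorem pderiv_pow_mul_pow {n : ℕ} (i : Fin n) {l s : MvPolynomial (Fin n) ℂ} {c : ℂ}
    (hl : pderiv i l = C c) (hs : pderiv i s = 1) (N k : ℕ) :
    ((pderiv i).toLinearMap ^ k : Module.End ℂ (MvPolynomial (Fin n) ℂ)) (l * s ^ N) =
      (N.descFactorial k : MvPolynomial (Fin n) ℂ) * (l * s ^ (N - k)) +
        (k * N.descFactorial (k - 1) : MvPolynomial (Fin n) ℂ) * (C c * s ^ (N - (k - 1))) := by
  induction k with
  | zero => simp
  | succ k ih =>
    rw [pow_succ', Module.End.mul_apply, ih]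
    rcases k with _ | k
    · simp [hl, hs]
      ring
    · simp only [Derivation.coeFn_coe, map_add, pderiv_mul, pderiv_pow, hl, hs, pderiv_C,
        Derivation.map_natCast, Nat.add_sub_cancel, Nat.descFactorial_succ, Nat.sub_sub]
      push_cast
      ring

theorem pderiv_pow_eq_zero {n : ℕ} {i : Fin n} {f : MvPolynomial (Fin n) ℂ} (hf : pderiv i f = 0)
    {k : ℕ} (hk : 1 ≤ k) :
    ((pderiv i).toLinearMap ^ k : Module.End ℂ (MvPolynomial (Fin n) ℂ)) f = 0 := by
  obtain ⟨k, rfl⟩ := Nat.exists_eq_add_of_le' hk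
  rw [pow_succ, Module.End.mul_apply]
  exact (congrArg _ hf).trans (map_zero _)

/-- For `i, j ∈ A`, the polynomial `(xᵢ - xⱼ) (∑_{l ∈ A} xₗ)ᴺ` is `q`-harmonic for
`q = -|A| / (N + 1)`. -/
theorem sub_mul_sum_pow_mem_harmonics {n : ℕ} {A : Finset (Fin n)} {i j : Fin n} (hi : i ∈ A)
    (hj : j ∈ A) {q : ℂ} {N : ℕ} (hq : q * (N + 1) + A.card = 0) :
    (X i - X j) * (∑ l ∈ A, X l) ^ N ∈ harmonics n q := by
  set s : MvPolynomial (Fin n) ℂ := ∑ l ∈ A, X l with hs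
  set δ : Fin n → ℂ := fun l => (if l = i then 1 else 0) - (if l = j then 1 else 0) with hδ
  have hl : ∀ l, pderiv l (X i - X j : MvPolynomial (Fin n) ℂ) = C (δ l) := fun l => by
    simp only [hδ, map_sub, pderiv_X, Pi.single_apply, eq_comm (a := l),
      apply_ite (C (σ := Fin n) (R := ℂ)), map_one, map_zero]
  have hout : ∀ l ∉ A, pderiv l ((X i - X j) * s ^ N) = 0 := fun l hlA => by
    have h1 : δ l = 0 := by
      have := ne_of_mem_of_not_mem hi hlA
      have := ne_of_mem_of_not_mem hj hlA
      simp [*, Ne.symm]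
    have h2 : pderiv l s = 0 := by rw [hs, pderiv_sum_X, if_neg hlA]
    rw [pderiv_mul, pderiv_pow, hl, h1, h2]
    simp
  have hin := fun l (hlA : l ∈ A) =>
    pderiv_pow_mul_pow l (hl l) (s := s) (by rw [hs, pderiv_sum_X, if_pos hlA]) N
  have hδsum : ∑ l ∈ A, C (σ := Fin n) (δ l) = 0 := by
    rw [← map_sum]
    simp [hδ, Finset.sum_sub_distrib, hi, hj]
  have hδX : ∑ l ∈ A, X l * C (δ l) = (X i - X j : MvPolynomial (Fin n) ℂ) := by
    simp [hδ, mul_sub, Finset.sum_sub_distrib, hi, hj, apply_ite (C (σ := Fin n) (R := ℂ))]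
  intro k hk
  have h1 : nabla n k ((X i - X j) * s ^ N) =
      (A.card : MvPolynomial (Fin n) ℂ) *
        ((N.descFactorial k : MvPolynomial (Fin n) ℂ) * ((X i - X j) * s ^ (N - k))) := by
    rw [nabla, LinearMap.sum_apply, ← Finset.sum_subset A.subset_univ fun l _ hlA =>
      pderiv_pow_eq_zero (hout l hlA) hk, Finset.sum_congr rfl fun l hlA => hin l hlA k,
      Finset.sum_add_distrib, Finset.sum_const, nsmul_eq_mul, ← Finset.mul_sum, ← Finset.sum_mul,
      hδsum]
    ring
  have hpow : (N.descFactorial (k + 1) : MvPolynomial (Fin n) ℂ) * (s * s ^ (N - (k + 1))) =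
      ((N : MvPolynomial (Fin n) ℂ) - k) * N.descFactorial k * s ^ (N - k) := by
    rcases lt_trichotomy N k with h | rfl | h
    · rw [Nat.descFactorial_of_lt h, Nat.descFactorial_of_lt (h.trans k.lt_succ_self)]
      simp
    · simp
    · rw [← pow_succ', Nat.descFactorial_succ, show N - (k + 1) + 1 = N - k by omega,
        Nat.cast_mul, Nat.cast_sub h.le]
  -- The two Leibniz terms contribute `N - k` and `k + 1`, so `D_{k;q}` multiplies a common
  -- polynomial by `q(N + 1) + |A|`.
  have h2 : dTilde n k ((X i - X j) * s ^ N) =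
      (N + 1 : MvPolynomial (Fin n) ℂ) *
        ((N.descFactorial k : MvPolynomial (Fin n) ℂ) * ((X i - X j) * s ^ (N - k))) := by
    have hterm : ∀ l ∈ A, (LinearMap.mulLeft ℂ (X l) * (pderiv l).toLinearMap ^ (k + 1) :
        Module.End ℂ (MvPolynomial (Fin n) ℂ)) ((X i - X j) * s ^ N) =
        X l * ((N.descFactorial (k + 1) : MvPolynomial (Fin n) ℂ) *
          ((X i - X j) * s ^ (N - (k + 1)))) +
          X l * C (δ l) *
            (((k + 1) * N.descFactorial k : MvPolynomial (Fin n) ℂ) * s ^ (N - k)) := fun l hlA => by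
      rw [Module.End.mul_apply, hin l hlA, LinearMap.mulLeft_apply, Nat.add_sub_cancel]
      push_cast
      ring
    rw [dTilde, LinearMap.sum_apply, ← Finset.sum_subset A.subset_univ fun l _ hlA => by
        rw [Module.End.mul_apply, pderiv_pow_eq_zero (hout l hlA) (by omega), map_zero],
      Finset.sum_congr rfl hterm, Finset.sum_add_distrib, ← Finset.sum_mul, ← Finset.sum_mul, hδX,
      ← hs]
    linear_combination (X i - X j) * hpow
  change q • dTilde n k _ + nabla n k _ = 0
  rw [h1, h2, smul_eq_C_mul, ← mul_assoc, ← add_mul]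
  have hC := congrArg (C (σ := Fin n)) hq
  simp only [map_add, map_mul, map_natCast, map_one, map_zero] at hC
  rw [hC, zero_mul]

theorem isSingular_of_two_le {n a b : ℕ} (ha : 2 ≤ a) (han : a ≤ n) (hb : n ≤ b) :
    IsSingular n (-((a : ℂ) / (b : ℂ))) := by
  obtain ⟨N, rfl⟩ : ∃ N, b = N + 1 := ⟨b - 1, by omega⟩
  have : NeZero n := ⟨by omega⟩
  let i : Fin n := ⟨0, by omega⟩
  let j : Fin n := ⟨1, by omega⟩
  have hij : i ≠ j := by simp [i, j]
  obtain ⟨A, hA, -, hcard⟩ := Finset.exists_subsuperset_card_eq (Finset.subset_univ {i, j})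
    (n := a) (by rwa [Finset.card_pair hij]) (by simpa using han)
  have hi : i ∈ A := hA (by simp)
  have hj : j ∈ A := hA (by simp)
  have hN : (N : ℂ) + 1 ≠ 0 := Nat.cast_add_one_ne_zero N
  refine isSingular_of_coeff_ne_zero (by omega) hb i
    (sub_mul_sum_pow_mem_harmonics (N := N) hi hj ?_) ?_ ?_
  · rw [hcard]
    push_cast
    field_simp
    ring
  · have h := ((isHomogeneous_X ℂ i).sub (isHomogeneous_X ℂ j)).mul
      ((IsHomogeneous.sum A (fun l => (X l : MvPolynomial (Fin n) ℂ)) 1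
        fun l _ => isHomogeneous_X ℂ l).pow N)
    rwa [one_mul, add_comm] at h
  · have h : ∀ N, coeff (Finsupp.single i N) ((∑ l ∈ A, X l : MvPolynomial (Fin n) ℂ) ^ N) = 1 := by
      intro N
      induction N with
      | zero => simp
      | succ N ih =>
        rw [pow_succ, Finset.mul_sum, coeff_sum, Finset.sum_eq_single_of_mem i hi,
          Finsupp.single_add, coeff_mul_X, ih]
        intro l _ hl
        rw [coeff_mul_X', if_neg]
        simp [hl.symm]
    rw [mul_comm, mul_sub, coeff_sub, Finsupp.single_add, coeff_mul_X, h, coeff_mul_X', if_neg]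
    · simp
    · rw [← Finsupp.single_add]
      simp [hij]

end QHarmonics

theorem mainTheorem1 (n : ℕ) (hn : 2 ≤ n) (a b : ℕ) (ha : 1 ≤ a) (han : a ≤ n) (hb : n ≤ b) :
    QHarmonics.IsSingular n (-((a : ℂ) / (b : ℂ))) := by
  rcases ha.eq_or_lt with rfl | ha'
  -- A singleton `A` has no two distinct indices, so `-1/b` is written as `-2/(2b)`.
  · have h := QHarmonics.isSingular_of_two_le (n := n) (a := 2) (b := 2 * b) le_rfl hn (by omega)
    have hb' : (b : ℂ) ≠ 0 := Nat.cast_ne_zero.2 (by omega)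
    convert h using 2
    push_cast
    field_simp
  · exact QHarmonics.isSingular_of_two_le ha' han hb
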